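/- Let $d\in\mathbb N$, let $\Omega\subset\mathbb R^d$ be a bounded open set (for example a bounded Lipschitz domain), let $\lambda$ be Lebesgue measure, and let $\phi\in C_c^\infty(\Omega;\mathbb R^d)$, extended by $0$ to $\mathbb R^d$. Put $f_t(x)=x+t\phi(x)$ for $t\in\mathbb R$, $x\in\mathbb{R}^d$. For a Lebesgue measurable set $E\subset\Omega$ let $$P(E,\Omega)=\sup\Bigl\{\int_E\operatorname{div}\varphi\,dx \;:\; \varphi\in C_c^1(\Omega;\mathbb R^d),\ \sup_{x\in\Omega}\|\varphi(x)\|\le 1\Bigr\}$$ be its perimeter in $\Omega$, and call $E$ a Caccioppoli set in $\Omega$ if $P(E,\Omega)<\infty$. Then for every $\varepsilon>0$ there exist $\varepsilon_0\in(0,\varepsilon)$ and $L>0$ such that the following two assertions hold. (1) For all $s,t\in(-\varepsilon_0,\varepsilon_0)$ and all Caccioppoli sets $E,F$ in $\Omega$, $$\bigl|\lambda(f_t(E)\cap F)-\lambda(f_s(E)\cap F)\bigr|\le L\,|t-s|\,P(E,\Omega).$$ (2) Let $E_1,\dots,E_M\subset\Omega$ be a finite Caccioppoli partition of $\Omega$,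 that is, the $E_i$ are Lebesgue measurable, pairwise disjoint up to null sets, cover $\Omega$ up to a null set, and satisfy $\sum_{i=1}^M P(E_i,\Omega)<\infty$. Let $\nu_1,\dots,\nu_M\in\mathbb R$, $v=\sum_{i=1}^M\nu_i\chi_{E_i}$ and $f_t^{\#}v=\sum_{i=1}^M\nu_i\chi_{f_t(E_i)}$. Then there is $C>0$ such that for all $t\in(-\varepsilon_0,\varepsilon_0)$ the function $f_t^{\#}v-v$ belongs to $L^1(\Omega)$ and $$\|f_t^{\#}v-v\|_{L^1(\Omega)}\le C|t|.$$ -/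

import Mathlib

open MeasureTheory
open scoped ENNReal ContDiff

noncomputable section

/-- `φ ∈ C_c^n(Ω; ℝ^d)`, as a function on `ℝ^d` (extended by zero outside `Ω`). -/
structure IsTestField {d : ℕ} (n : ℕ∞) (Ω : Set (EuclideanSpace ℝ (Fin d)))
    (φ : EuclideanSpace ℝ (Fin d) → EuclideanSpace ℝ (Fin d)) : Prop where
  contDiff : ContDiff ℝ n φ
  hasCompactSupport : HasCompactSupport φ
  tsupport_subset : tsupport φ ⊆ Ω

/-- The divergence `∑ i, ∂φ_i/∂x_i`. -/
def divergence {d : ℕ} (φ : EuclideanSpace ℝ (Fin d) → EuclideanSpace ℝ (Fin d))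
    (x : EuclideanSpace ℝ (Fin d)) : ℝ :=
  ∑ i, (fderiv ℝ φ x (EuclideanSpace.single i 1)) i

/-- The perimeter `P(E, Ω) = sup { ∫_E div φ | φ ∈ C_c^1(Ω; ℝ^d), ‖φ‖ ≤ 1 } ∈ [0, ∞]`.
Since `φ = 0` is admissible the supremum is nonnegative, so that truncating the integrals
at `0` by `ENNReal.ofReal` does not change it. -/
def perimeter {d : ℕ} (E Ω : Set (EuclideanSpace ℝ (Fin d))) : ℝ≥0∞ :=
  ⨆ (φ : EuclideanSpace ℝ (Fin d) → EuclideanSpace ℝ (Fin d))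
    (_ : IsTestField 1 Ω φ) (_ : ∀ x, ‖φ x‖ ≤ 1),
    ENNReal.ofReal (∫ x in E, divergence φ x)

/-- A Caccioppoli set in `Ω`: a Lebesgue measurable subset of `Ω` of finite perimeter in `Ω`. -/
structure IsCaccioppoliSet {d : ℕ} (Ω E : Set (EuclideanSpace ℝ (Fin d))) : Prop where
  subset : E ⊆ Ω
  nullMeasurableSet : NullMeasurableSet E volume
  perimeter_lt_top : perimeter E Ω < ⊤

/-- A Caccioppoli partition of `Ω`. As usual, the sets need to be disjoint and to cover `Ω` only
up to Lebesgue null sets; every partition in the strict sense is included. -/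
structure IsCaccioppoliPartition {d : ℕ} {ι : Type*} (Ω : Set (EuclideanSpace ℝ (Fin d)))
    (E : ι → Set (EuclideanSpace ℝ (Fin d))) : Prop where
  subset : ∀ i, E i ⊆ Ω
  nullMeasurableSet : ∀ i, NullMeasurableSet (E i) volume
  aedisjoint : Pairwise fun i j => AEDisjoint volume (E i) (E j)
  cover : volume (Ω \ ⋃ i, E i) = 0
  tsum_perimeter_lt_top : ∑' i, perimeter (E i) Ω < ⊤

/-- The map `f_t = I + t φ`. -/
def variationMap {d : ℕ} (φ : EuclideanSpace ℝ (Fin d) → EuclideanSpace ℝ (Fin d)) (t : ℝ)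
    (x : EuclideanSpace ℝ (Fin d)) : EuclideanSpace ℝ (Fin d) :=
  x + t • φ x

/-- The piecewise constant function `∑ i, ν_i χ_{E_i}`. -/
def stepFunction {d M : ℕ} (ν : Fin M → ℝ) (E : Fin M → Set (EuclideanSpace ℝ (Fin d)))
    (x : EuclideanSpace ℝ (Fin d)) : ℝ :=
  ∑ i, (E i).indicator (fun _ => ν i) x

/-- The function `f^# v = ∑ i, ν_i χ_{f(E_i)}` for `v = ∑ i, ν_i χ_{E_i}`. -/
def pushStepFunction {d M : ℕ} (f : EuclideanSpace ℝ (Fin d) → EuclideanSpace ℝ (Fin d))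
    (ν : Fin M → ℝ) (E : Fin M → Set (EuclideanSpace ℝ (Fin d))) :
    EuclideanSpace ℝ (Fin d) → ℝ :=
  stepFunction ν fun i => f '' E i

end

/-!
The estimate is a statement about `λ(f_t(E) ∆ f_s(E))`, and for small `t` the set `f_t(E)` is the
preimage of `E` under the inverse `h_t` of `f_t`, which is a Lipschitz perturbation of the identity
that moves no point outside the support of `φ` and satisfies `‖h_t - h_s‖ ≤ 2 sup ‖φ‖ |t - s|`.

For a `C¹` function `u` in place of the indicator function of `E`, write `u ∘ h_t - u ∘ h_s` as the
integral of `Du` along the segments from `h_s x` to `h_t x`. For each fixed parameter the points on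
these segments are again the image of `x` under a Lipschitz perturbation of the identity, whose
effect on volume is bounded by `2 ^ d` through Hausdorff measure; no Jacobians are involved. This
gives `∫ |u ∘ h_t - u ∘ h_s| ≤ 2 ^ d sup ‖h_t - h_s‖ ∫_{K'} ‖Du‖`, with `K'` a compact
neighbourhood in `Ω` of the support of `φ` (`lintegral_enorm_comp_sub_comp_le`).

Take for `u` the convolution of the indicator function of `E` with a bump function `ρ`. Then
`∫_{K'} ‖Du‖ ≤ P(E, Ω)` (`lintegral_fderiv_mollifiedIndicator_le_perimeter`): the left side is the
pairing of `Du` with the bounded field `∇u / |∇u|` cut off outside `K'`, and moving the kernel to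
the other side of the pairing turns it into the integral over `E` of the divergence of the field
smoothed by `ρ`, which is an admissible test field. As the radius of `ρ` tends to `0`, the functions
`u` converge almost everywhere to the indicator function by Lebesgue differentiation, and Fatou's
lemma yields the bound for the symmetric difference
(`exists_volume_symmDiff_image_variationMap_le`). Both assertions follow by the triangle inequality.
-/

open Set Metric Filter Topology
open scoped NNReal symmDiff Convolution

/-! ### Volume under antilipschitz maps -/

theorem AntilipschitzWith.volume_preimage_le {d : ℕ} {K : ℝ≥0}
    {f : EuclideanSpace ℝ (Fin d) → EuclideanSpace ℝ (Fin d)} (hf : AntilipschitzWith K f)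
    (s : Set (EuclideanSpace ℝ (Fin d))) :
    volume (f ⁻¹' s) ≤ (K : ℝ≥0∞) ^ d * volume s := by
  -- Lebesgue measure is a multiple of the `d`-dimensional Hausdorff measure.
  rw [← EuclideanSpace.euclideanHausdorffMeasure_eq_volume,
    Measure.euclideanHausdorffMeasure_def, Measure.smul_apply, Measure.smul_apply,
    ENNReal.smul_def, ENNReal.smul_def, smul_eq_mul, smul_eq_mul, mul_left_comm]
  gcongr
  simpa using hf.hausdorffMeasure_preimage_le (d := (d : ℝ)) (Nat.cast_nonneg d) s

theorem AntilipschitzWith.map_volume_le {d : ℕ} {K : ℝ≥0}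
    {f : EuclideanSpace ℝ (Fin d) → EuclideanSpace ℝ (Fin d)} (hf : AntilipschitzWith K f)
    (hfm : Measurable f) :
    (volume : Measure (EuclideanSpace ℝ (Fin d))).map f ≤ ((K : ℝ≥0∞) ^ d) • volume := by
  refine Measure.le_iff.2 fun s hs => ?_
  rw [Measure.map_apply hfm hs, Measure.smul_apply, smul_eq_mul]
  exact hf.volume_preimage_le s

theorem AntilipschitzWith.lintegral_comp_le {d : ℕ} {K : ℝ≥0}
    {f : EuclideanSpace ℝ (Fin d) → EuclideanSpace ℝ (Fin d)} (hf : AntilipschitzWith K f)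
    (hfm : Measurable f) {g : EuclideanSpace ℝ (Fin d) → ℝ≥0∞} (hg : Measurable g) :
    ∫⁻ x, g (f x) ≤ (K : ℝ≥0∞) ^ d * ∫⁻ x, g x := by
  rw [← lintegral_map hg hfm, ← smul_eq_mul, ← lintegral_smul_measure]
  exact lintegral_mono' (hf.map_volume_le hfm) le_rfl

theorem AntilipschitzWith.quasiMeasurePreserving_volume {d : ℕ} {K : ℝ≥0}
    {f : EuclideanSpace ℝ (Fin d) → EuclideanSpace ℝ (Fin d)} (hf : AntilipschitzWith K f)
    (hfm : Measurable f) : Measure.QuasiMeasurePreserving f volume volume :=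
  ⟨hfm, (Measure.absolutelyContinuous_of_le (hf.map_volume_le hfm)).trans
    Measure.smul_absolutelyContinuous⟩

/-- A map that differs from the identity by a `1 / 2`-Lipschitz map shrinks distances by a factor
of at most `2`. -/
theorem antilipschitzWith_two_of_lipschitzWith_sub_id {V : Type*} [NormedAddCommGroup V]
    {p : V → V} (hp : LipschitzWith (1 / 2) fun x => p x - x) : AntilipschitzWith 2 p := by
  refine AntilipschitzWith.of_le_mul_dist fun x y => ?_
  have h := hp.dist_le_mul x y
  have h2 : x - y = (p x - p y) - ((p x - x) - (p y - y)) := by abel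
  have h3 := norm_sub_le (p x - p y) ((p x - x) - (p y - y))
  rw [← h2] at h3
  simp only [dist_eq_norm] at *
  push_cast at *
  linarith

/-! ### Perturbations of the identity -/

/-- Increments of a `C¹` function along two maps are controlled by the integral of its derivative
along the segments that join them. -/
theorem enorm_sub_le_lintegral_fderiv_segment {V : Type*} [NormedAddCommGroup V] [NormedSpace ℝ V]
    {u : V → ℝ} (hu : ContDiff ℝ 1 u) (a b : V) :
    ‖u b - u a‖ₑ ≤ ∫⁻ θ in Ioc (0 : ℝ) 1, ‖fderiv ℝ u (a + θ • (b - a))‖ₑ * ‖b - a‖ₑ := by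
  have hd : ∀ θ : ℝ, HasDerivAt (fun θ : ℝ => u (a + θ • (b - a)))
      (fderiv ℝ u (a + θ • (b - a)) (b - a)) θ := fun θ => by
    have h1 : HasDerivAt (fun θ : ℝ => a + θ • (b - a)) (b - a) θ := by
      simpa using ((hasDerivAt_id θ).smul_const (b - a)).const_add a
    exact ((hu.differentiable one_ne_zero) _).hasFDerivAt.comp_hasDerivAt θ h1
  have hc : Continuous fun θ : ℝ => fderiv ℝ u (a + θ • (b - a)) (b - a) :=
    ((hu.continuous_fderiv one_ne_zero).comp (by fun_prop)).clm_apply continuous_const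
  have h := intervalIntegral.integral_eq_sub_of_hasDerivAt (fun θ _ => hd θ)
    (hc.intervalIntegrable 0 1)
  simp only [one_smul, zero_smul, add_zero, add_sub_cancel] at h
  rw [← h, intervalIntegral.integral_of_le zero_le_one]
  refine (enorm_integral_le_lintegral_enorm _).trans (lintegral_mono fun θ => ?_)
  exact ContinuousLinearMap.le_opENorm _ _

/-- Composing `u` with two small Lipschitz perturbations of the identity that agree off `K` changes
it in `L¹` by at most a multiple of the variation of `u` near `K`: each map `x ↦ p x + θ (q x - p x)`
is a perturbation of the same kind, and so distorts volume by a factor of at most `2 ^ d`. -/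
theorem lintegral_enorm_comp_sub_comp_le {d : ℕ} {u : EuclideanSpace ℝ (Fin d) → ℝ}
    (hu : ContDiff ℝ 1 u) {p q : EuclideanSpace ℝ (Fin d) → EuclideanSpace ℝ (Fin d)}
    (hp : LipschitzWith (1 / 2) fun x => p x - x) (hq : LipschitzWith (1 / 2) fun x => q x - x)
    {K : Set (EuclideanSpace ℝ (Fin d))} (hK : ∀ x ∉ K, p x = q x) {δ m : ℝ}
    (hpδ : ∀ x, ‖p x - x‖ ≤ δ) (hqδ : ∀ x, ‖q x - x‖ ≤ δ) (hm : ∀ x, ‖q x - p x‖ ≤ m) :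
    ∫⁻ x, ‖u (q x) - u (p x)‖ₑ ≤
      ENNReal.ofReal m * (2 ^ d * ∫⁻ x in cthickening δ K, ‖fderiv ℝ u x‖ₑ) := by
  have hpc : Continuous p := by
    simpa [Pi.add_def] using hp.continuous.add continuous_id
  have hqc : Continuous q := by
    simpa [Pi.add_def] using hq.continuous.add continuous_id
  set z : ℝ → EuclideanSpace ℝ (Fin d) → EuclideanSpace ℝ (Fin d) :=
    fun θ x => p x + θ • (q x - p x) with hz
  have hzc : Continuous fun w : EuclideanSpace ℝ (Fin d) × ℝ => z w.2 w.1 := by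
    simp only [hz]; fun_prop
  have hzsub : ∀ θ x, z θ x - x = (1 - θ) • (p x - x) + θ • (q x - x) := fun θ x => by
    simp only [hz]; module
  have hzl : ∀ θ ∈ Ioc (0 : ℝ) 1, LipschitzWith (1 / 2) fun x => z θ x - x := by
    rintro θ ⟨h0, h1⟩
    refine LipschitzWith.of_dist_le_mul fun x y => ?_
    have e : (z θ x - x) - (z θ y - y) =
        (1 - θ) • ((p x - x) - (p y - y)) + θ • ((q x - x) - (q y - y)) := by
      rw [hzsub, hzsub]; module
    have hpx := hp.dist_le_mul x y
    have hqx := hq.dist_le_mul x y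
    rw [dist_eq_norm] at hpx hqx ⊢
    rw [e]
    refine (norm_add_le _ _).trans ?_
    rw [norm_smul, norm_smul, Real.norm_of_nonneg h0.le, Real.norm_of_nonneg (sub_nonneg.2 h1)]
    nlinarith [mul_le_mul_of_nonneg_left hpx (sub_nonneg.2 h1), mul_le_mul_of_nonneg_left hqx h0.le]
  have hzδ : ∀ θ ∈ Ioc (0 : ℝ) 1, ∀ x, ‖z θ x - x‖ ≤ δ := by
    rintro θ ⟨h0, h1⟩ x
    rw [hzsub]
    refine (norm_add_le _ _).trans ?_
    rw [norm_smul, norm_smul, Real.norm_of_nonneg h0.le, Real.norm_of_nonneg (sub_nonneg.2 h1)]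
    nlinarith [mul_le_mul_of_nonneg_left (hpδ x) (sub_nonneg.2 h1),
      mul_le_mul_of_nonneg_left (hqδ x) h0.le]
  set G : EuclideanSpace ℝ (Fin d) → ℝ≥0∞ :=
    (cthickening δ K).indicator fun x => ‖fderiv ℝ u x‖ₑ with hG
  have hGm : Measurable G :=
    (hu.continuous_fderiv one_ne_zero).measurable.enorm.indicator
      isClosed_cthickening.measurableSet
  have hGz : Measurable fun w : EuclideanSpace ℝ (Fin d) × ℝ => G (z w.2 w.1) :=
    hGm.comp hzc.measurable
  have hpt : ∀ x, ‖u (q x) - u (p x)‖ₑ ≤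
      ENNReal.ofReal m * ∫⁻ θ in Ioc (0 : ℝ) 1, G (z θ x) := by
    intro x
    by_cases hx : x ∈ K
    · refine (enorm_sub_le_lintegral_fderiv_segment hu (p x) (q x)).trans ?_
      rw [← lintegral_const_mul' _ _ ENNReal.ofReal_ne_top]
      refine setLIntegral_mono_ae' measurableSet_Ioc (Eventually.of_forall fun θ hθ => ?_)
      have hmem : z θ x ∈ cthickening δ K :=
        mem_cthickening_of_dist_le _ x _ _ hx (by rw [dist_eq_norm]; exact hzδ θ hθ x)
      rw [mul_comm, hG, indicator_of_mem hmem]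
      gcongr
      rw [← ofReal_norm]
      exact ENNReal.ofReal_le_ofReal (hm x)
    · simp [hK x hx]
  calc ∫⁻ x, ‖u (q x) - u (p x)‖ₑ
      ≤ ∫⁻ x, ENNReal.ofReal m * ∫⁻ θ in Ioc (0 : ℝ) 1, G (z θ x) := lintegral_mono hpt
    _ = ENNReal.ofReal m * ∫⁻ θ in Ioc (0 : ℝ) 1, ∫⁻ x, G (z θ x) := by
      rw [lintegral_const_mul' _ _ ENNReal.ofReal_ne_top,
        lintegral_lintegral_swap (f := fun x θ => G (z θ x)) hGz.aemeasurable]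
    _ ≤ ENNReal.ofReal m * ∫⁻ _ in Ioc (0 : ℝ) 1, 2 ^ d * ∫⁻ x, G x := by
      refine mul_le_mul' le_rfl
        (setLIntegral_mono_ae' measurableSet_Ioc (Eventually.of_forall fun θ hθ => ?_))
      exact (antilipschitzWith_two_of_lipschitzWith_sub_id (hzl θ hθ)).lintegral_comp_le
        (hzc.comp (Continuous.prodMk_left θ)).measurable hGm
    _ = _ := by
      rw [hG, lintegral_indicator isClosed_cthickening.measurableSet]
      simp

/-! ### Smoothing and the total variation -/

/-- The smoothing of the indicator function of `E` by the bump function `ρ`. -/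
noncomputable def mollifiedIndicator {d : ℕ} (ρ : ContDiffBump (0 : EuclideanSpace ℝ (Fin d)))
    (E : Set (EuclideanSpace ℝ (Fin d))) : EuclideanSpace ℝ (Fin d) → ℝ :=
  ρ.normed volume ⋆[ContinuousLinearMap.lsmul ℝ ℝ, volume] E.indicator fun _ => (1 : ℝ)

/-- The smoothing of a vector field by the bump function `ρ`. -/
noncomputable def mollifiedField {d : ℕ} (ρ : ContDiffBump (0 : EuclideanSpace ℝ (Fin d)))
    (ψ : EuclideanSpace ℝ (Fin d) → EuclideanSpace ℝ (Fin d)) :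
    EuclideanSpace ℝ (Fin d) → EuclideanSpace ℝ (Fin d) :=
  ρ.normed volume ⋆[ContinuousLinearMap.lsmul ℝ ℝ, volume] ψ

section Mollify

variable {d : ℕ} (ρ : ContDiffBump (0 : EuclideanSpace ℝ (Fin d)))

theorem locallyIntegrable_indicator_one {E : Set (EuclideanSpace ℝ (Fin d))}
    (hE : MeasurableSet E) : LocallyIntegrable (E.indicator fun _ => (1 : ℝ)) volume :=
  (locallyIntegrable_const (1 : ℝ)).indicator hE

theorem contDiff_mollifiedIndicator {E : Set (EuclideanSpace ℝ (Fin d))}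
    (hE : MeasurableSet E) : ContDiff ℝ 1 (mollifiedIndicator ρ E) :=
  ρ.hasCompactSupport_normed.contDiff_convolution_left (n := 1) _ ρ.contDiff_normed
    (locallyIntegrable_indicator_one hE)

theorem fderiv_mollifiedIndicator_apply {E : Set (EuclideanSpace ℝ (Fin d))}
    (hE : MeasurableSet E) (x v : EuclideanSpace ℝ (Fin d)) :
    fderiv ℝ (mollifiedIndicator ρ E) x v =
      ∫ y in E, fderiv ℝ (ρ.normed volume) (x - y) v := by
  have h := (ρ.hasCompactSupport_normed (μ := volume)).hasFDerivAt_convolution_left (μ := volume)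
    (ContinuousLinearMap.lsmul ℝ ℝ) (ρ.contDiff_normed (n := 1))
    (locallyIntegrable_indicator_one hE) x
  have hi : ConvolutionExistsAt (fderiv ℝ (ρ.normed volume)) (E.indicator fun _ => (1 : ℝ)) x
      ((ContinuousLinearMap.lsmul ℝ ℝ).precompL (EuclideanSpace ℝ (Fin d))) volume :=
    ((ρ.hasCompactSupport_normed (μ := volume)).fderiv ℝ).convolutionExists_left _
      ((ρ.contDiff_normed (n := 1)).continuous_fderiv one_ne_zero)
      (locallyIntegrable_indicator_one hE) x
  rw [mollifiedIndicator, h.fderiv, convolution_eq_swap,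
    ContinuousLinearMap.integral_apply hi.integrable_swap, ← integral_indicator hE]
  refine integral_congr_ae (Eventually.of_forall fun y => ?_)
  by_cases hy : y ∈ E <;> simp [hy, ContinuousLinearMap.precompL_apply]

theorem contDiff_mollifiedField {ψ : EuclideanSpace ℝ (Fin d) → EuclideanSpace ℝ (Fin d)}
    (hψ : Integrable ψ) : ContDiff ℝ 1 (mollifiedField ρ ψ) :=
  ρ.hasCompactSupport_normed.contDiff_convolution_left (n := 1) _ ρ.contDiff_normed
    hψ.locallyIntegrable

/-- The divergence of a smoothed field, with all derivatives on the kernel: the field is only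
assumed integrable. -/
theorem divergence_mollifiedField {ψ : EuclideanSpace ℝ (Fin d) → EuclideanSpace ℝ (Fin d)}
    (hψ : Integrable ψ) (y : EuclideanSpace ℝ (Fin d)) :
    divergence (mollifiedField ρ ψ) y =
      ∫ x, fderiv ℝ (ρ.normed volume) (y - x) (ψ x) := by
  have h := (ρ.hasCompactSupport_normed (μ := volume)).hasFDerivAt_convolution_left (μ := volume)
    (ContinuousLinearMap.lsmul ℝ ℝ) (ρ.contDiff_normed (n := 1)) hψ.locallyIntegrable y
  have hi : ConvolutionExistsAt (fderiv ℝ (ρ.normed volume)) ψ y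
      ((ContinuousLinearMap.lsmul ℝ ℝ).precompL (EuclideanSpace ℝ (Fin d))) volume :=
    ((ρ.hasCompactSupport_normed (μ := volume)).fderiv ℝ).convolutionExists_left _
      ((ρ.contDiff_normed (n := 1)).continuous_fderiv one_ne_zero) hψ.locallyIntegrable y
  have hi' := hi.integrable_swap
  have hi2 : ∀ i : Fin d, Integrable fun x =>
      fderiv ℝ (ρ.normed volume) (y - x) (EuclideanSpace.single i 1) * ψ x i := fun i => by
    have := (((EuclideanSpace.proj i : EuclideanSpace ℝ (Fin d) →L[ℝ] ℝ)).comp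
      (ContinuousLinearMap.apply ℝ _ (EuclideanSpace.single i (1 : ℝ)))).integrable_comp hi'
    simpa [ContinuousLinearMap.precompL_apply] using this
  rw [divergence, mollifiedField, h.fderiv, convolution_eq_swap]
  have hcomp : ∀ i : Fin d, ((∫ x, ((ContinuousLinearMap.lsmul ℝ ℝ).precompL
      (EuclideanSpace ℝ (Fin d)) (fderiv ℝ (ρ.normed volume) (y - x))) (ψ x))
        (EuclideanSpace.single i (1 : ℝ))) i =
      ∫ x, fderiv ℝ (ρ.normed volume) (y - x) (EuclideanSpace.single i 1) * ψ x i := fun i => by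
    have := (((EuclideanSpace.proj i : EuclideanSpace ℝ (Fin d) →L[ℝ] ℝ)).comp
      (ContinuousLinearMap.apply ℝ _ (EuclideanSpace.single i (1 : ℝ)))).integral_comp_comm hi'
    simpa [ContinuousLinearMap.precompL_apply] using this.symm
  rw [Finset.sum_congr rfl fun i _ => hcomp i, ← integral_finsetSum _ fun i _ => hi2 i]
  refine integral_congr_ae (Eventually.of_forall fun x => ?_)
  have hx : ψ x = ∑ i, ψ x i • EuclideanSpace.single i (1 : ℝ) := by
    ext j; simp [Finset.sum_apply, Pi.single_apply]
  dsimp only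
  conv_rhs => rw [hx]
  simp [map_sum, mul_comm]

theorem norm_mollifiedField_le {ψ : EuclideanSpace ℝ (Fin d) → EuclideanSpace ℝ (Fin d)}
    (hψ : AEStronglyMeasurable ψ) (hψ1 : ∀ x, ‖ψ x‖ ≤ 1) (y : EuclideanSpace ℝ (Fin d)) :
    ‖mollifiedField ρ ψ y‖ ≤ 1 := by
  have := dist_convolution_le (μ := volume) (f := ρ.normed volume) (g := ψ) (x₀ := y)
    (R := ρ.rOut) (ε := 1) (z₀ := 0) zero_le_one ρ.support_normed_eq.subset ρ.nonneg_normed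
    ρ.integral_normed hψ (fun x _ => by simpa using hψ1 x)
  simpa [mollifiedField] using this

theorem tsupport_mollifiedField_subset
    {ψ : EuclideanSpace ℝ (Fin d) → EuclideanSpace ℝ (Fin d)}
    {K : Set (EuclideanSpace ℝ (Fin d))} (hψK : Function.support ψ ⊆ K) :
    tsupport (mollifiedField ρ ψ) ⊆ cthickening ρ.rOut K := by
  refine closure_minimal ?_ isClosed_cthickening
  refine (support_convolution_subset _).trans ?_
  rintro _ ⟨a, ha, b, hb, rfl⟩
  rw [ρ.support_normed_eq, mem_ball_zero_iff] at ha
  exact mem_cthickening_of_dist_le _ b _ _ (hψK hb) (by simpa [dist_eq_norm] using ha.le)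

/-- Integration by parts for a smoothed indicator function: the derivatives fall on the symmetric
kernel, so that the field itself need not be differentiable. -/
theorem integral_fderiv_mollifiedIndicator_apply {E : Set (EuclideanSpace ℝ (Fin d))}
    (hE : MeasurableSet E) (hE' : volume E ≠ ⊤)
    {ψ : EuclideanSpace ℝ (Fin d) → EuclideanSpace ℝ (Fin d)} (hψ : Integrable ψ) :
    ∫ x, fderiv ℝ (mollifiedIndicator ρ E) x (ψ x) =
      - ∫ y in E, divergence (mollifiedField ρ ψ) y := by
  have hodd : ∀ z, fderiv ℝ (ρ.normed volume) (-z) = - fderiv ℝ (ρ.normed volume) z := by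
    intro z
    have h : (fun w => ρ.normed volume (-w)) = ρ.normed volume := funext fun w => ρ.normed_neg w
    have h2 := fderiv_comp_smul (f := ρ.normed volume) (x := z) (-1 : ℝ)
    simp only [neg_smul, one_smul, h] at h2
    rw [h2, neg_neg]
  have hcont : Continuous (fderiv ℝ (ρ.normed volume)) :=
    (ρ.contDiff_normed (n := 1)).continuous_fderiv one_ne_zero
  obtain ⟨C, hC⟩ := (ρ.hasCompactSupport_normed.fderiv ℝ).exists_bound_of_continuous hcont
  have : IsFiniteMeasure (volume.restrict E) := ⟨by simpa using hE'.lt_top⟩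
  have hint : Integrable (fun w : EuclideanSpace ℝ (Fin d) × EuclideanSpace ℝ (Fin d) =>
      fderiv ℝ (ρ.normed volume) (w.1 - w.2) (ψ w.1)) (volume.prod (volume.restrict E)) := by
    have h1 : Integrable (fun w : EuclideanSpace ℝ (Fin d) × EuclideanSpace ℝ (Fin d) =>
        ψ w.1) (volume.prod (volume.restrict E)) := hψ.comp_fst _
    refine (h1.norm.const_mul C).mono' ?_ (Eventually.of_forall fun w => ?_)
    · have h2 : AEStronglyMeasurable (fun w : EuclideanSpace ℝ (Fin d) ×
          EuclideanSpace ℝ (Fin d) => fderiv ℝ (ρ.normed volume) (w.1 - w.2))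
          (volume.prod (volume.restrict E)) :=
        (hcont.comp (continuous_fst.sub continuous_snd)).aestronglyMeasurable
      exact (ContinuousLinearMap.id ℝ _).aestronglyMeasurable_comp₂ h2 h1.1
    · exact ContinuousLinearMap.le_of_opNorm_le _ (hC _) _
  simp_rw [fderiv_mollifiedIndicator_apply ρ hE, divergence_mollifiedField ρ hψ]
  rw [integral_integral_swap hint, ← integral_neg]
  refine integral_congr_ae (Eventually.of_forall fun y => ?_)
  dsimp only
  rw [← integral_neg]
  refine integral_congr_ae (Eventually.of_forall fun x => ?_)
  dsimp only
  rw [← neg_sub y x, hodd, neg_apply]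

/-- Smoothing an indicator function does not increase its total variation. The perimeter is tested
with the smoothing of the normalised gradient, cut off outside `K`. -/
theorem lintegral_fderiv_mollifiedIndicator_le_perimeter {E Ω K : Set (EuclideanSpace ℝ (Fin d))}
    (hE : MeasurableSet E) (hE' : volume E ≠ ⊤) (hK : IsCompact K)
    (hKΩ : cthickening ρ.rOut K ⊆ Ω) :
    ∫⁻ x in K, ‖fderiv ℝ (mollifiedIndicator ρ E) x‖ₑ ≤ perimeter E Ω := by
  have hu := contDiff_mollifiedIndicator ρ hE
  set u := mollifiedIndicator ρ E
  have hdu : Continuous (fderiv ℝ u) := hu.continuous_fderiv one_ne_zero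
  have hgrad : Continuous (gradient u) :=
    (InnerProductSpace.toDual ℝ (EuclideanSpace ℝ (Fin d))).symm.continuous.comp hdu
  set ψ : EuclideanSpace ℝ (Fin d) → EuclideanSpace ℝ (Fin d) :=
    K.indicator fun x => ‖gradient u x‖⁻¹ • gradient u x with hψdef
  have hψm : Measurable ψ :=
    ((hgrad.norm.measurable.inv).smul hgrad.measurable).indicator hK.measurableSet
  have hψ1 : ∀ x, ‖ψ x‖ ≤ 1 := fun x => by
    by_cases hx : x ∈ K
    · rw [hψdef, indicator_of_mem hx, norm_smul, norm_inv, norm_norm]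
      exact inv_mul_le_one
    · rw [hψdef, indicator_of_notMem hx, norm_zero]; exact zero_le_one
  have hψK : Function.support ψ ⊆ K := support_indicator_subset
  have hψi : Integrable ψ := by
    rw [← integrableOn_iff_integrable_of_support_subset hψK]
    exact Measure.integrableOn_of_bounded hK.measure_lt_top.ne hψm.aestronglyMeasurable
      (Eventually.of_forall hψ1)
  have hpt : ∀ x, fderiv ℝ u x (ψ x) = K.indicator (fun x => ‖fderiv ℝ u x‖) x := fun x => by
    by_cases hx : x ∈ K
    · have h1 : ∀ v, fderiv ℝ u x v = inner ℝ (gradient u x) v := fun v => by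
        rw [gradient, InnerProductSpace.toDual_symm_apply]
      have h2 : ‖gradient u x‖ = ‖fderiv ℝ u x‖ := by rw [gradient, LinearIsometryEquiv.norm_map]
      rw [h1, hψdef, indicator_of_mem hx, indicator_of_mem hx, inner_smul_right,
        real_inner_self_eq_norm_sq, h2, sq, ← mul_assoc]
      by_cases h0 : ‖fderiv ℝ u x‖ = 0
      · simp [h0]
      · rw [inv_mul_cancel₀ h0, one_mul]
    · simp [hψdef, hx]
  have hψneg : Integrable (-ψ) := hψi.neg
  have hsub := tsupport_mollifiedField_subset ρ (ψ := -ψ) (K := K) (by simpa using hψK)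
  have hfield : IsTestField 1 Ω (mollifiedField ρ (-ψ)) :=
    ⟨contDiff_mollifiedField ρ hψneg,
      hK.cthickening.of_isClosed_subset (isClosed_tsupport _) hsub, hsub.trans hKΩ⟩
  have key := integral_fderiv_mollifiedIndicator_apply ρ hE hE' hψneg
  -- The sign of the field compensates the sign of the integration by parts.
  have hlhs : ∫ x, fderiv ℝ u x ((-ψ) x) = - ∫ x in K, ‖fderiv ℝ u x‖ := by
    rw [← integral_indicator hK.measurableSet, ← integral_neg]
    exact integral_congr_ae (Eventually.of_forall fun x => by simp [hpt x])
  rw [hlhs, neg_inj] at key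
  have hint : IntegrableOn (fun x => ‖fderiv ℝ u x‖) K :=
    hdu.norm.continuousOn.integrableOn_compact hK
  calc ∫⁻ x in K, ‖fderiv ℝ u x‖ₑ = ENNReal.ofReal (∫ x in K, ‖fderiv ℝ u x‖) := by
        rw [ofReal_integral_eq_lintegral_ofReal hint (Eventually.of_forall fun x => norm_nonneg _)]
        simp only [ofReal_norm]
    _ = ENNReal.ofReal (∫ x in E, divergence (mollifiedField ρ (-ψ)) x) := by rw [key]
    _ ≤ perimeter E Ω :=
        le_iSup_of_le (mollifiedField ρ (-ψ)) (le_iSup_of_le hfield (le_iSup_of_le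
          (norm_mollifiedField_le ρ hψneg.1 (fun x => by simpa using hψ1 x)) le_rfl))

end Mollify

/-! ### Symmetric differences of preimages -/

theorem perimeter_congr_ae {d : ℕ} {E E' : Set (EuclideanSpace ℝ (Fin d))} (h : E =ᵐ[volume] E')
    (Ω : Set (EuclideanSpace ℝ (Fin d))) : perimeter E Ω = perimeter E' Ω := by
  simp only [perimeter, setIntegral_congr_set h]

theorem enorm_indicator_one_sub_indicator_one {α : Type*} (A B : Set α) (x : α) :
    ‖A.indicator (fun _ => (1 : ℝ)) x - B.indicator (fun _ => (1 : ℝ)) x‖ₑ =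
      (A ∆ B).indicator (fun _ => (1 : ℝ≥0∞)) x := by
  by_cases hA : x ∈ A <;> by_cases hB : x ∈ B <;> simp [hA, hB, mem_symmDiff]

/-- Small Lipschitz perturbations of the identity that agree off a compact subset of `Ω` have
preimages of `E` whose symmetric difference is controlled by the perimeter. -/
theorem volume_symmDiff_preimage_le {d : ℕ} {E Ω K : Set (EuclideanSpace ℝ (Fin d))}
    (hE : MeasurableSet E) (hE' : volume E ≠ ⊤) (hK : IsCompact K) {δ : ℝ} (hδ : 0 < δ)
    (hKΩ : cthickening (δ + δ) K ⊆ Ω)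
    {p q : EuclideanSpace ℝ (Fin d) → EuclideanSpace ℝ (Fin d)}
    (hp : LipschitzWith (1 / 2) fun x => p x - x) (hq : LipschitzWith (1 / 2) fun x => q x - x)
    (hpq : ∀ x ∉ K, p x = q x) {m : ℝ} (hpδ : ∀ x, ‖p x - x‖ ≤ δ) (hqδ : ∀ x, ‖q x - x‖ ≤ δ)
    (hm : ∀ x, ‖q x - p x‖ ≤ m) :
    volume ((q ⁻¹' E) ∆ (p ⁻¹' E)) ≤ ENNReal.ofReal m * (2 ^ d * perimeter E Ω) := by
  have hpc : Continuous p := by simpa [Pi.add_def] using hp.continuous.add continuous_id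
  have hqc : Continuous q := by simpa [Pi.add_def] using hq.continuous.add continuous_id
  have hpm := (antilipschitzWith_two_of_lipschitzWith_sub_id hp).quasiMeasurePreserving_volume
    hpc.measurable
  have hqm := (antilipschitzWith_two_of_lipschitzWith_sub_id hq).quasiMeasurePreserving_volume
    hqc.measurable
  -- Bumps whose ratio of radii stays bounded, as Lebesgue differentiation requires.
  let ρ : ℕ → ContDiffBump (0 : EuclideanSpace ℝ (Fin d)) := fun n =>
    { rIn := δ / (n + 1) / 2
      rOut := δ / (n + 1)
      rIn_pos := by positivity
      rIn_lt_rOut := half_lt_self (by positivity) }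
  have hρ : Tendsto (fun n => (ρ n).rOut) atTop (𝓝 0) := by
    have := (tendsto_one_div_add_atTop_nhds_zero_nat (𝕜 := ℝ)).const_mul δ
    simpa [ρ, div_eq_mul_inv] using this
  have hρδ : ∀ n, (ρ n).rOut ≤ δ := fun n => div_le_self hδ.le (by simp)
  have hρr : ∀ᶠ n in atTop, (ρ n).rOut ≤ 2 * (ρ n).rIn :=
    Eventually.of_forall fun n => le_of_eq (by simp only [ρ]; ring)
  have hlim := ContDiffBump.ae_convolution_tendsto_right_of_locallyIntegrable hρ hρr
    (locallyIntegrable_indicator_one hE)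
  have hbound : ∀ n, ∫⁻ x, ‖mollifiedIndicator (ρ n) E (q x) - mollifiedIndicator (ρ n) E (p x)‖ₑ
      ≤ ENNReal.ofReal m * (2 ^ d * perimeter E Ω) := fun n => by
    refine (lintegral_enorm_comp_sub_comp_le (contDiff_mollifiedIndicator (ρ n) hE) hp hq hpq
      hpδ hqδ hm).trans ?_
    gcongr
    refine lintegral_fderiv_mollifiedIndicator_le_perimeter (ρ n) hE hE' hK.cthickening ?_
    exact ((cthickening_mono (hρδ n) _).trans
      (cthickening_cthickening_subset hδ.le hδ.le K)).trans hKΩ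
  have hcont : ∀ n, Continuous (mollifiedIndicator (ρ n) E) := fun n =>
    (contDiff_mollifiedIndicator (ρ n) hE).continuous
  have hmeas : MeasurableSet ((q ⁻¹' E) ∆ (p ⁻¹' E)) :=
    (hqc.measurable hE).symmDiff (hpc.measurable hE)
  calc volume ((q ⁻¹' E) ∆ (p ⁻¹' E))
      = ∫⁻ x, ((q ⁻¹' E) ∆ (p ⁻¹' E)).indicator (fun _ => (1 : ℝ≥0∞)) x := by
        rw [lintegral_indicator hmeas, setLIntegral_one]
    _ = ∫⁻ x, liminf (fun n =>
          ‖mollifiedIndicator (ρ n) E (q x) - mollifiedIndicator (ρ n) E (p x)‖ₑ) atTop := by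
        refine lintegral_congr_ae ?_
        filter_upwards [hqm.ae hlim, hpm.ae hlim] with x hx hy
        rw [← enorm_indicator_one_sub_indicator_one]
        exact ((hx.sub hy).enorm.liminf_eq).symm
    _ ≤ liminf (fun n => ∫⁻ x,
          ‖mollifiedIndicator (ρ n) E (q x) - mollifiedIndicator (ρ n) E (p x)‖ₑ) atTop :=
        lintegral_liminf_le fun n =>
          (((hcont n).comp hqc).sub ((hcont n).comp hpc)).measurable.enorm
    _ ≤ ENNReal.ofReal m * (2 ^ d * perimeter E Ω) :=
        liminf_le_of_le (by isBoundedDefault) fun b hb => by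
          obtain ⟨n, hn⟩ := hb.exists
          exact hn.trans (hbound n)

theorem volume_symmDiff_preimage_le_of_nullMeasurableSet {d : ℕ}
    {E Ω K : Set (EuclideanSpace ℝ (Fin d))}
    (hE : NullMeasurableSet E volume) (hE' : volume E ≠ ⊤) (hK : IsCompact K) {δ : ℝ} (hδ : 0 < δ)
    (hKΩ : cthickening (δ + δ) K ⊆ Ω)
    {p q : EuclideanSpace ℝ (Fin d) → EuclideanSpace ℝ (Fin d)}
    (hp : LipschitzWith (1 / 2) fun x => p x - x) (hq : LipschitzWith (1 / 2) fun x => q x - x)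
    (hpq : ∀ x ∉ K, p x = q x) {m : ℝ} (hpδ : ∀ x, ‖p x - x‖ ≤ δ) (hqδ : ∀ x, ‖q x - x‖ ≤ δ)
    (hm : ∀ x, ‖q x - p x‖ ≤ m) :
    volume ((q ⁻¹' E) ∆ (p ⁻¹' E)) ≤ ENNReal.ofReal m * (2 ^ d * perimeter E Ω) := by
  have hpc : Continuous p := by simpa [Pi.add_def] using hp.continuous.add continuous_id
  have hqc : Continuous q := by simpa [Pi.add_def] using hq.continuous.add continuous_id
  have hpm := (antilipschitzWith_two_of_lipschitzWith_sub_id hp).quasiMeasurePreserving_volume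
    hpc.measurable
  have hqm := (antilipschitzWith_two_of_lipschitzWith_sub_id hq).quasiMeasurePreserving_volume
    hqc.measurable
  obtain ⟨E', hE'm, hEE'⟩ := hE
  rw [perimeter_congr_ae hEE', measure_congr
    ((hqm.preimage_ae_eq hEE').symmDiff (hpm.preimage_ae_eq hEE'))]
  exact volume_symmDiff_preimage_le hE'm (by rwa [← measure_congr hEE']) hK hδ hKΩ hp hq hpq
    hpδ hqδ hm

/-! ### The variation `f_t` and its inverse -/

section Variation

variable {d : ℕ} {φ : EuclideanSpace ℝ (Fin d) → EuclideanSpace ℝ (Fin d)}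

/-- For small `t` the map `f_t` is a Lipschitz perturbation of the identity with small constant,
hence a homeomorphism of the whole space. -/
theorem exists_homeomorph_eq_variationMap {Λ : ℝ≥0} (hφ : LipschitzWith Λ φ) {t : ℝ}
    (ht : |t| * Λ ≤ 1 / 4) :
    ∃ h : EuclideanSpace ℝ (Fin d) ≃ₜ EuclideanSpace ℝ (Fin d), ⇑h = variationMap φ t := by
  have happ : ApproximatesLinearOn (variationMap φ t)
      (ContinuousLinearEquiv.refl ℝ (EuclideanSpace ℝ (Fin d)) :
        EuclideanSpace ℝ (Fin d) →L[ℝ] EuclideanSpace ℝ (Fin d)) univ (1 / 4) := by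
    intro x _ y _
    have e : variationMap φ t x - variationMap φ t y - (x - y) = t • (φ x - φ y) := by
      simp only [variationMap]; module
    have h := hφ.dist_le_mul x y
    simp only [ContinuousLinearEquiv.coe_refl, ContinuousLinearMap.coe_id', id_eq]
    rw [e, norm_smul, Real.norm_eq_abs]
    rw [dist_eq_norm, dist_eq_norm] at h
    push_cast
    nlinarith [mul_le_mul_of_nonneg_left h (abs_nonneg t),
      mul_le_mul_of_nonneg_right ht (norm_nonneg (x - y))]
  refine ⟨happ.toHomeomorph _ ?_, rfl⟩
  rcases subsingleton_or_nontrivial (EuclideanSpace ℝ (Fin d)) with hs | hn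
  · exact Or.inl hs
  · right
    have h1 : ‖((ContinuousLinearEquiv.refl ℝ (EuclideanSpace ℝ (Fin d))).symm :
        EuclideanSpace ℝ (Fin d) →L[ℝ] EuclideanSpace ℝ (Fin d))‖₊ = 1 := by
      rw [ContinuousLinearEquiv.refl_symm, ContinuousLinearEquiv.coe_refl]
      exact NNReal.eq ContinuousLinearMap.norm_id
    rw [h1, inv_one, ← NNReal.coe_lt_coe]
    norm_num

theorem symm_sub_self_of_eq_variationMap {t : ℝ}
    {h : EuclideanSpace ℝ (Fin d) ≃ₜ EuclideanSpace ℝ (Fin d)} (hh : ⇑h = variationMap φ t)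
    (x : EuclideanSpace ℝ (Fin d)) : h.symm x - x = -(t • φ (h.symm x)) := by
  have h1 := h.apply_symm_apply x
  rw [hh, variationMap] at h1
  rw [sub_eq_iff_eq_add, ← sub_eq_neg_add, eq_sub_iff_add_eq]
  exact h1

theorem lipschitzWith_symm_sub_id_of_eq_variationMap {Λ : ℝ≥0} (hφ : LipschitzWith Λ φ) {t : ℝ}
    (ht : |t| * Λ ≤ 1 / 4) {h : EuclideanSpace ℝ (Fin d) ≃ₜ EuclideanSpace ℝ (Fin d)}
    (hh : ⇑h = variationMap φ t) : LipschitzWith (1 / 2) fun x => h.symm x - x := by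
  refine LipschitzWith.of_dist_le_mul fun x y => ?_
  have hL := hφ.dist_le_mul (h.symm x) (h.symm y)
  have e : (h.symm x - x) - (h.symm y - y) = -(t • (φ (h.symm x) - φ (h.symm y))) := by
    rw [symm_sub_self_of_eq_variationMap hh, symm_sub_self_of_eq_variationMap hh]; module
  have e2 : h.symm x - h.symm y = (x - y) + ((h.symm x - x) - (h.symm y - y)) := by abel
  have h2 := norm_add_le (x - y) ((h.symm x - x) - (h.symm y - y))
  rw [← e2] at h2
  simp only [dist_eq_norm] at hL ⊢
  have h3 : ‖(h.symm x - x) - (h.symm y - y)‖ ≤ 1 / 4 * ‖h.symm x - h.symm y‖ := by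
    rw [e, norm_neg, norm_smul, Real.norm_eq_abs]
    nlinarith [mul_le_mul_of_nonneg_left hL (abs_nonneg t),
      mul_le_mul_of_nonneg_right ht (norm_nonneg (h.symm x - h.symm y))]
  push_cast
  linarith [norm_nonneg (x - y)]

/-- The inverses of `f_t` depend on `t` in a Lipschitz way, uniformly in space. -/
theorem norm_symm_sub_symm_le_of_eq_variationMap {Λ : ℝ≥0} (hφ : LipschitzWith Λ φ) {B : ℝ}
    (hB : ∀ x, ‖φ x‖ ≤ B) {s t : ℝ} (hs : |s| * Λ ≤ 1 / 4)
    {g h : EuclideanSpace ℝ (Fin d) ≃ₜ EuclideanSpace ℝ (Fin d)}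
    (hg : ⇑g = variationMap φ s) (hh : ⇑h = variationMap φ t) (x : EuclideanSpace ℝ (Fin d)) :
    ‖h.symm x - g.symm x‖ ≤ 2 * B * |t - s| := by
  have hL := hφ.dist_le_mul (h.symm x) (g.symm x)
  have e : h.symm x - g.symm x =
      -((t - s) • φ (h.symm x) + s • (φ (h.symm x) - φ (g.symm x))) := by
    rw [← sub_sub_sub_cancel_right _ _ x, symm_sub_self_of_eq_variationMap hh,
      symm_sub_self_of_eq_variationMap hg]
    module
  have h1 := norm_add_le ((t - s) • φ (h.symm x)) (s • (φ (h.symm x) - φ (g.symm x)))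
  rw [← norm_neg, ← e, norm_smul, norm_smul, Real.norm_eq_abs, Real.norm_eq_abs] at h1
  simp only [dist_eq_norm] at hL
  nlinarith [mul_le_mul_of_nonneg_left hL (abs_nonneg s),
    mul_le_mul_of_nonneg_right hs (norm_nonneg (h.symm x - g.symm x)),
    mul_le_mul_of_nonneg_left (hB (h.symm x)) (abs_nonneg (t - s)),
    norm_nonneg (h.symm x - g.symm x)]

theorem image_variationMap_zero (E : Set (EuclideanSpace ℝ (Fin d))) :
    variationMap φ 0 '' E = E := by
  have : variationMap φ 0 = id := funext fun x => by simp [variationMap]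
  rw [this, image_id]

/-- The curve `t ↦ f_t(E)` is Lipschitz for the measure of the symmetric difference, at a rate
proportional to the perimeter of `E` and uniform in `E`. -/
theorem exists_volume_symmDiff_image_variationMap_le {Ω : Set (EuclideanSpace ℝ (Fin d))}
    (hΩ : IsOpen Ω) (hΩb : Bornology.IsBounded Ω) (hφ : IsTestField (⊤ : ℕ∞) Ω φ)
    {ε : ℝ} (hε : 0 < ε) :
    ∃ ε₀ L : ℝ, 0 < ε₀ ∧ ε₀ < ε ∧ 0 < L ∧
      ∀ E : Set (EuclideanSpace ℝ (Fin d)), E ⊆ Ω → NullMeasurableSet E volume →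
        (∀ t : ℝ, |t| < ε₀ → NullMeasurableSet (variationMap φ t '' E) volume) ∧
        ∀ s t : ℝ, |s| < ε₀ → |t| < ε₀ →
          volume ((variationMap φ t '' E) ∆ (variationMap φ s '' E)) ≤
            ENNReal.ofReal (L * |t - s|) * perimeter E Ω := by
  have hφ1 : ContDiff ℝ 1 φ := hφ.contDiff.of_le (by exact_mod_cast le_top)
  obtain ⟨Λ, hΛ⟩ := hφ1.lipschitzWith_of_hasCompactSupport hφ.hasCompactSupport one_ne_zero
  obtain ⟨B, hB⟩ := hφ.hasCompactSupport.exists_bound_of_continuous hφ.contDiff.continuous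
  have hB0 : 0 ≤ B := (norm_nonneg _).trans (hB 0)
  have hK : IsCompact (tsupport φ) := hφ.hasCompactSupport
  -- Half of the collar around the support of `φ` is used up by the displacements of the maps,
  -- the other half by the radius of the smoothing kernels.
  obtain ⟨δ', hδ', hδΩ⟩ := hK.exists_cthickening_subset_open hΩ hφ.tsupport_subset
  obtain ⟨δ, hδ, rfl⟩ : ∃ δ : ℝ, 0 < δ ∧ δ' = δ + δ := ⟨δ' / 2, half_pos hδ', (add_halves δ').symm⟩
  have hΛ0 : (0 : ℝ) ≤ Λ := Λ.2
  refine ⟨min (ε / 2) (min (1 / (4 * (Λ + 1))) (δ / (B + 1))), 2 * B * 2 ^ d + 1, by positivity,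
    (min_le_left _ _).trans_lt (half_lt_self hε), by positivity, fun E hEΩ hE => ?_⟩
  have hsmall : ∀ t : ℝ, |t| < min (ε / 2) (min (1 / (4 * (Λ + 1))) (δ / (B + 1))) →
      |t| * Λ ≤ 1 / 4 ∧ |t| * B ≤ δ := fun t ht => by
    have h1 := ht.le.trans ((min_le_right _ _).trans (min_le_left _ _))
    have h2 := ht.le.trans ((min_le_right _ _).trans (min_le_right _ _))
    rw [le_div_iff₀ (by positivity)] at h1 h2
    constructor <;> nlinarith [abs_nonneg t]
  have himage : ∀ {t : ℝ} {h : EuclideanSpace ℝ (Fin d) ≃ₜ EuclideanSpace ℝ (Fin d)},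
      ⇑h = variationMap φ t → variationMap φ t '' E = h.symm ⁻¹' E := fun {t h} hh => by
    rw [← hh, h.image_eq_preimage_symm]
  refine ⟨fun t ht => ?_, fun s t hs ht => ?_⟩
  · obtain ⟨h, hh⟩ := exists_homeomorph_eq_variationMap hΛ (hsmall t ht).1
    rw [himage hh]
    exact hE.preimage ((antilipschitzWith_two_of_lipschitzWith_sub_id
      (lipschitzWith_symm_sub_id_of_eq_variationMap hΛ (hsmall t ht).1
        hh)).quasiMeasurePreserving_volume h.symm.continuous.measurable)
  · obtain ⟨h, hh⟩ := exists_homeomorph_eq_variationMap hΛ (hsmall t ht).1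
    obtain ⟨g, hg⟩ := exists_homeomorph_eq_variationMap hΛ (hsmall s hs).1
    have hoff : ∀ {t : ℝ} {h : EuclideanSpace ℝ (Fin d) ≃ₜ EuclideanSpace ℝ (Fin d)},
        ⇑h = variationMap φ t → ∀ x ∉ tsupport φ, h.symm x = x := fun {t h} hh x hx => by
      rw [Homeomorph.symm_apply_eq, hh, variationMap, image_eq_zero_of_notMem_tsupport hx,
        smul_zero, add_zero]
    have hdisp : ∀ {t : ℝ} {h : EuclideanSpace ℝ (Fin d) ≃ₜ EuclideanSpace ℝ (Fin d)},
        ⇑h = variationMap φ t → |t| * B ≤ δ → ∀ x, ‖h.symm x - x‖ ≤ δ := fun {t h} hh ht x => by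
      rw [symm_sub_self_of_eq_variationMap hh, norm_neg, norm_smul, Real.norm_eq_abs]
      exact (mul_le_mul_of_nonneg_left (hB _) (abs_nonneg t)).trans ht
    have hE' : volume E ≠ ⊤ := ((measure_mono hEΩ).trans_lt hΩb.measure_lt_top).ne
    have key := volume_symmDiff_preimage_le_of_nullMeasurableSet hE hE' hK hδ hδΩ
      (lipschitzWith_symm_sub_id_of_eq_variationMap hΛ (hsmall s hs).1 hg)
      (lipschitzWith_symm_sub_id_of_eq_variationMap hΛ (hsmall t ht).1 hh)
      (fun x hx => (hoff hg x hx).trans (hoff hh x hx).symm)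
      (hdisp hg (hsmall s hs).2) (hdisp hh (hsmall t ht).2)
      (norm_symm_sub_symm_le_of_eq_variationMap hΛ hB (hsmall s hs).1 hg hh)
    rw [himage hh, himage hg]
    refine key.trans ?_
    have h2 : (2 : ℝ≥0∞) ^ d = ENNReal.ofReal (2 ^ d) := by
      rw [ENNReal.ofReal_pow zero_le_two, ENNReal.ofReal_ofNat]
    rw [← mul_assoc, h2, ← ENNReal.ofReal_mul (by positivity)]
    refine mul_le_mul' (ENNReal.ofReal_le_ofReal ?_) le_rfl
    linarith [abs_nonneg (t - s)]

end Variation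

/-! ### Measures of intersections and norms of step functions -/

theorem eLpNorm_indicator_const_sub_indicator_const_le {α : Type*} [MeasurableSpace α]
    (μ : Measure α) (A B : Set α) (c : ℝ) :
    eLpNorm (A.indicator (fun _ => c) - B.indicator fun _ => c) 1 μ ≤ ‖c‖ₑ * μ (A ∆ B) := by
  have hle : ∀ x, ‖(A.indicator (fun _ => c) - B.indicator fun _ => c) x‖ ≤
      ‖(A ∆ B).indicator (fun _ => c) x‖ := fun x => by
    by_cases hA : x ∈ A <;> by_cases hB : x ∈ B <;> simp [hA, hB, mem_symmDiff]
  refine (eLpNorm_mono hle).trans ((eLpNorm_indicator_const_le c 1).trans ?_)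
  simp

theorem abs_measureReal_inter_sub_le {α : Type*} [MeasurableSpace α] {μ : Measure α}
    {A B F : Set α} (hF : μ F ≠ ⊤) (hAB : μ (A ∆ B) ≠ ⊤) :
    |μ.real (A ∩ F) - μ.real (B ∩ F)| ≤ μ.real (A ∆ B) := by
  have key : ∀ {A B : Set α}, μ (A ∆ B) ≠ ⊤ → μ.real (A ∩ F) ≤ μ.real (B ∩ F) + μ.real (A ∆ B) :=
    fun {A B} hAB => by
      refine (measureReal_mono ?_ (measure_union_ne_top
        (measure_ne_top_of_subset inter_subset_right hF) hAB)).trans (measureReal_union_le _ _)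
      intro x hx
      by_cases hB : x ∈ B
      · exact Or.inl ⟨hB, hx.2⟩
      · exact Or.inr (Or.inl ⟨hx.1, hB⟩)
  have h1 := key hAB
  have h2 := key (by rwa [symmDiff_comm] : μ (B ∆ A) ≠ ⊤)
  rw [symmDiff_comm B A] at h2
  rw [abs_le]
  constructor <;> linarith

theorem mainTheorem7 {d : ℕ} (Ω : Set (EuclideanSpace ℝ (Fin d)))
    (hΩ : IsOpen Ω) (hΩb : Bornology.IsBounded Ω)
    (φ : EuclideanSpace ℝ (Fin d) → EuclideanSpace ℝ (Fin d)) (hφ : IsTestField (⊤ : ℕ∞) Ω φ)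
    (ε : ℝ) (hε : 0 < ε) :
    ∃ ε₀ L : ℝ, 0 < ε₀ ∧ ε₀ < ε ∧ 0 < L ∧
      (∀ s t : ℝ, |s| < ε₀ → |t| < ε₀ →
        ∀ E F : Set (EuclideanSpace ℝ (Fin d)), IsCaccioppoliSet Ω E → IsCaccioppoliSet Ω F →
          |volume.real (variationMap φ t '' E ∩ F) - volume.real (variationMap φ s '' E ∩ F)| ≤
            L * |t - s| * (perimeter E Ω).toReal) ∧
      (∀ (M : ℕ) (E : Fin M → Set (EuclideanSpace ℝ (Fin d))) (ν : Fin M → ℝ),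
        IsCaccioppoliPartition Ω E →
          ∃ C : ℝ, 0 < C ∧ ∀ t : ℝ, |t| < ε₀ →
            MemLp (pushStepFunction (variationMap φ t) ν E - stepFunction ν E) 1
              (volume.restrict Ω) ∧
            eLpNorm (pushStepFunction (variationMap φ t) ν E - stepFunction ν E) 1
              (volume.restrict Ω) ≤ ENNReal.ofReal (C * |t|)) := by
  obtain ⟨ε₀, L, hε₀, hε₀ε, hL, key⟩ :=
    exists_volume_symmDiff_image_variationMap_le hΩ hΩb hφ hε
  refine ⟨ε₀, L, hε₀, hε₀ε, hL, fun s t hs ht E F hE hF => ?_, fun M E ν hE => ?_⟩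
  · have h := (key E hE.subset hE.nullMeasurableSet).2 s t hs ht
    have hfin : ENNReal.ofReal (L * |t - s|) * perimeter E Ω ≠ ⊤ :=
      ENNReal.mul_ne_top ENNReal.ofReal_ne_top hE.perimeter_lt_top.ne
    refine (abs_measureReal_inter_sub_le
      ((measure_mono hF.subset).trans_lt hΩb.measure_lt_top).ne
      (h.trans_lt hfin.lt_top).ne).trans ?_
    refine (ENNReal.toReal_mono hfin h).trans_eq ?_
    rw [ENNReal.toReal_mul, ENNReal.toReal_ofReal (by positivity)]
  · have hP : ∀ i, perimeter (E i) Ω ≠ ⊤ := fun i =>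
      ((ENNReal.le_tsum i).trans_lt hE.tsum_perimeter_lt_top).ne
    -- The summand `1` keeps the constant positive when all perimeters or all values vanish.
    refine ⟨∑ i, |ν i| * (L * (perimeter (E i) Ω).toReal) + 1, by positivity, fun t ht => ?_⟩
    set w : Fin M → EuclideanSpace ℝ (Fin d) → ℝ := fun i =>
      (variationMap φ t '' E i).indicator (fun _ => ν i) - (E i).indicator fun _ => ν i with hw
    have hsum : pushStepFunction (variationMap φ t) ν E - stepFunction ν E = ∑ i, w i := by
      funext x
      simp [pushStepFunction, stepFunction, hw, Finset.sum_apply]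
    have hwm : ∀ i, AEStronglyMeasurable (w i) (volume.restrict Ω) := fun i => by
      have hm := (key (E i) (hE.subset i) (hE.nullMeasurableSet i)).1 t ht
      exact ((aestronglyMeasurable_const.indicator₀ hm).sub
        (aestronglyMeasurable_const.indicator₀ (hE.nullMeasurableSet i))).restrict
    have hwi : ∀ i, eLpNorm (w i) 1 (volume.restrict Ω) ≤
        ENNReal.ofReal (|ν i| * (L * (perimeter (E i) Ω).toReal) * |t|) := fun i => by
      have h := (key (E i) (hE.subset i) (hE.nullMeasurableSet i)).2 0 t (by simpa using hε₀) ht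
      rw [image_variationMap_zero, sub_zero] at h
      calc eLpNorm (w i) 1 (volume.restrict Ω)
          ≤ eLpNorm (w i) 1 volume := eLpNorm_mono_measure _ Measure.restrict_le_self
        _ ≤ ‖ν i‖ₑ * (ENNReal.ofReal (L * |t|) * perimeter (E i) Ω) :=
            (eLpNorm_indicator_const_sub_indicator_const_le _ _ _ _).trans
              (mul_le_mul' le_rfl h)
        _ = _ := by
            rw [← ofReal_norm, Real.norm_eq_abs, ← ENNReal.ofReal_toReal (hP i),
              ← ENNReal.ofReal_mul (by positivity), ← ENNReal.ofReal_mul (by positivity),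
              ENNReal.toReal_ofReal ENNReal.toReal_nonneg]
            ring_nf
    have hle : eLpNorm (pushStepFunction (variationMap φ t) ν E - stepFunction ν E) 1
        (volume.restrict Ω) ≤
        ENNReal.ofReal ((∑ i, |ν i| * (L * (perimeter (E i) Ω).toReal) + 1) * |t|) := by
      rw [hsum]
      refine (eLpNorm_sum_le (fun i _ => hwm i) le_rfl).trans
        ((Finset.sum_le_sum fun i _ => hwi i).trans ?_)
      rw [← ENNReal.ofReal_sum_of_nonneg fun i _ => by positivity, ← Finset.sum_mul]
      gcongr
      linarith
    refine ⟨⟨?_, hle.trans_lt ENNReal.ofReal_lt_top⟩, hle⟩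
    rw [hsum]
    exact Finset.aestronglyMeasurable_sum _ fun i _ => hwm i
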